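/- Let $A$ be a finite set with $q := |A| \ge 2$ elements and let $n \ge 2$ be an integer. An \emph{instruction} is a permutation $g$ of $A^n$ that changes at most one coordinate, i.e. for which there is an index $j \in \{1,\dots,n\}$ such that, for all $x \in A^n$ and all $i \neq j$, the $i$-th coordinate of $g(x)$ equals $x_i$ (in particular, the identity is an instruction). (a) Unless $q = n = 2$, there is a set of exactly $n$ instructions that generates the symmetric group $\mathrm{Sym}(A^n)$. (b) If $q \ge 3$, there is a set of exactly $n$ instructions that generates the alternating group $\mathrm{Alt}(A^n)$. -/

import Mathlib

/-- A permutation `g` of the set of states `A ^ n` *updates only the register `j`* if each of its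
coordinate functions other than the `j`-th one is trivial, that is, `(g x) i = x i` for every
state `x` and every `i ≠ j`. -/
def UpdatesOnly {A : Type*} {n : ℕ} (g : Equiv.Perm (Fin n → A)) (j : Fin n) : Prop :=
  ∀ (x : Fin n → A) (i : Fin n), i ≠ j → g x i = x i

/-- An *instruction* is a permutation of `A ^ n` with at most one nontrivial coordinate function.
(By convention the identity is an instruction.) -/
def IsInstruction {A : Type*} {n : ℕ} (g : Equiv.Perm (Fin n → A)) : Prop :=
  ∃ j : Fin n, UpdatesOnly g j

namespace Equiv.Perm

open scoped Pointwise

/-! ### Groups containing a transposition or a three-cycle, and their blocks -/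

section Jordan

variable {X : Type*} [Fintype X] [DecidableEq X]

/-! Let one register `i₀` carry an instruction applying `π y` when the other registers have values
`y`. At a single `y = o` the permutation `π o` is a transposition or a three-cycle, and some
exponent `N` fixes `π o` while killing every other `π y`. The `N`-th power is then a single
transposition or three-cycle of states. Each other register is moved by a transitive permutation `s`
of `A`, but only while register `i₀` has a value outside a set `B`.

Being joined by transpositions (or three-cycles) of a group is an equivalence relation invariant
under the group. So the group contains the symmetric (alternating) group as soon as no proper block
contains the support of one such element. Here a base state with `i₀`-value in `B` lies in the
support and is fixed by the instructions on the other registers, and also by the one on `i₀` once `π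
o` is divided out. These therefore preserve any block through it, and the block spreads to all
states (`IsLinking.block_eq_univ`). For the alternating group, `B` and the number of odd `π y` are
chosen so that every generator is even.

If `q = 2`, a transposition is the only nontrivial permutation of `A`, so orders cannot separate `o`
from the rest. Instead, for `n ≥ 3`, two instructions act as overlapping transpositions on a square
of four states and as commuting flips elsewhere; the square of their product is a three-cycle
(`flipUnless_mul_flipUnless_sq`). An odd generator then gives the whole symmetric group. -/

theorem IsThreeCycle.pow_three {h : Perm X} (hh : h.IsThreeCycle) : h ^ 3 = 1 := by
  rw [← hh.orderOf, pow_orderOf_eq_one]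

theorem IsThreeCycle.apply_apply_apply {h : Perm X} (hh : h.IsThreeCycle) (x : X) :
    h (h (h x)) = x := by
  simpa [pow_succ] using DFunLike.congr_fun hh.pow_three x

theorem IsThreeCycle.eq_or_eq_or_eq {h : Perm X} (hh : h.IsThreeCycle) {y z : X} (hy : h y ≠ y)
    (hz : h z ≠ z) : z = y ∨ z = h y ∨ z = h (h y) := by
  obtain ⟨i, hi⟩ := hh.isCycle.exists_pow_eq hy hz
  have h3 : (h ^ (i % 3)) y = z := by
    rw [← hi, ← hh.orderOf, pow_mod_orderOf]
  have : i % 3 < 3 := Nat.mod_lt _ (by norm_num)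
  interval_cases i % 3
  · exact .inl (by simpa using h3.symm)
  · exact .inr (.inl (by simpa using h3.symm))
  · exact .inr (.inr (by simpa [pow_two] using h3.symm))

theorem IsThreeCycle.conj {h : Perm X} (hh : h.IsThreeCycle) (g : Perm X) :
    (g * h * g⁻¹).IsThreeCycle := by
  rw [IsThreeCycle, cycleType_conj]; exact hh

/-- Two points are linked by `G` if they are equal or some three-cycle of `G` maps the first to
the second. -/
def ThreeCycleLinked (G : Subgroup (Perm X)) (x y : X) : Prop :=
  ∃ h ∈ G, (h = 1 ∨ h.IsThreeCycle) ∧ h x = y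

namespace ThreeCycleLinked

variable {G : Subgroup (Perm X)} {x y z : X}

theorem refl (x : X) : ThreeCycleLinked G x x := ⟨1, one_mem G, .inl rfl, rfl⟩

theorem symm (hxy : ThreeCycleLinked G x y) : ThreeCycleLinked G y x := by
  obtain ⟨h, hG, hh, rfl⟩ := hxy
  refine ⟨h⁻¹, inv_mem hG, ?_, by simp⟩
  rcases hh with rfl | hh
  · simp
  · exact .inr hh.inv

theorem map {g : Perm X} (hg : g ∈ G) (hxy : ThreeCycleLinked G x y) :
    ThreeCycleLinked G (g x) (g y) := by
  obtain ⟨h, hG, hh, rfl⟩ := hxy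
  refine ⟨g * h * g⁻¹, mul_mem (mul_mem hg hG) (inv_mem hg), ?_, by simp⟩
  rcases hh with rfl | hh
  · simp
  · exact .inr (hh.conj g)

/-- If `h` and `k` both move their points, then either one of `x`, `k (h x)` lies in the support of
the other cycle, and an inverse or the identity suffices, or `h⁻¹ * k * h` sends `x` to `k (h x)`.
-/
theorem trans (hxy : ThreeCycleLinked G x y) (hyz : ThreeCycleLinked G y z) :
    ThreeCycleLinked G x z := by
  obtain ⟨h, hG, rfl | hh, rfl⟩ := hxy
  · simpa using hyz
  obtain ⟨k, kG, rfl | hk, rfl⟩ := hyz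
  · exact ⟨h, hG, .inr hh, rfl⟩
  by_cases hky : k (h x) = h x
  · rw [hky]; exact ⟨h, hG, .inr hh, rfl⟩
  by_cases hhx : h x = x
  · rw [hhx]; exact ⟨k, kG, .inr hk, rfl⟩
  by_cases hkx : k x = x
  · by_cases hz : h (k (h x)) = k (h x)
    · refine ⟨h⁻¹ * k * h⁻¹⁻¹, mul_mem (mul_mem (inv_mem hG) kG) (inv_mem (inv_mem hG)),
        .inr (hk.conj _), ?_⟩
      rw [inv_inv, mul_apply, mul_apply, Perm.inv_eq_iff_eq, hz]
    · rcases hh.eq_or_eq_or_eq hhx hz with e | e | e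
      · rw [e]; exact refl x
      · exact absurd e hky
      · rw [e]
        refine ⟨h⁻¹, inv_mem hG, .inr hh.inv, ?_⟩
        rw [Perm.inv_eq_iff_eq, hh.apply_apply_apply]
  · rcases hk.eq_or_eq_or_eq hky hkx with e | e | e
    · exact absurd e.symm hhx
    · rw [← e]; exact refl x
    · refine ⟨k⁻¹, inv_mem kG, .inr hk.inv, ?_⟩
      rw [Perm.inv_eq_iff_eq, ← e]

end ThreeCycleLinked

/-- By Jordan's theorem primitivity is enough. A three-cycle `h` sending `a` in a block to `d`
outside it keeps any other point `b` of the block inside: it fixes `b`, or `b = h (h a)` and `h b =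
a`. So the image of the block meets the block without equalling it. -/
theorem alternatingGroup_le_of_forall_threeCycleLinked {G : Subgroup (Perm X)}
    {t : Perm X} (ht : t.IsThreeCycle) (htG : t ∈ G)
    (hG : ∀ x y, ThreeCycleLinked G x y) : alternatingGroup X ≤ G := by
  refine alternatingGroup_le_of_isPreprimitive_of_isThreeCycle_mem ?_ ht htG
  have : MulAction.IsPretransitive G X := ⟨fun x y => by
    obtain ⟨h, hh, -, e⟩ := hG x y
    exact ⟨⟨h, hh⟩, e⟩⟩
  refine ⟨fun {B} hB => ?_⟩
  by_contra hne
  simp only [MulAction.IsTrivialBlock, not_or, Set.not_subsingleton_iff] at hne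
  obtain ⟨⟨a, ha, b, hb, hab⟩, huniv⟩ := hne
  obtain ⟨d, hd⟩ := (Set.ne_univ_iff_exists_notMem B).1 huniv
  obtain ⟨h, hhG, rfl | hh, e⟩ := hG a d
  · exact hd (by simpa [← e] using ha)
  have key : h b ∈ B := by
    by_cases hbb : h b = b
    · rwa [hbb]
    have hda : h a ≠ a := fun e' => hd (by rwa [← e, e'])
    rcases hh.eq_or_eq_or_eq hda hbb with e' | e' | e'
    · exact absurd e'.symm hab
    · exact absurd (by rwa [← e, ← e']) hd
    · rwa [e', hh.apply_apply_apply]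
  have hst : (⟨h, hhG⟩ : G) • B = B := hB.smul_eq_of_mem hb key
  exact hd (hst ▸ ⟨a, ha, e⟩)

/-- A permutation group containing a three-cycle whose support is contained in no proper block
contains the alternating group. -/
theorem alternatingGroup_le_of_isThreeCycle_of_block {G : Subgroup (Perm X)}
    {t : Perm X} (ht : t.IsThreeCycle) (htG : t ∈ G)
    (hG : ∀ C : Set X, (∀ x, t x ≠ x → x ∈ C) →
      (∀ g ∈ G, ∀ p ∈ C, g p ∈ C → ∀ x ∈ C, g x ∈ C) → C = _root_.Set.univ) :
    alternatingGroup X ≤ G := by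
  obtain ⟨p, hp, -⟩ := ht.isCycle
  -- The class of a point moved by `t` contains the support of `t`, and invariance of the relation
  -- makes it a block.
  have huniv := hG {x | ThreeCycleLinked G p x} (fun x hx => ?_) (fun g hg q hq hgq x hx => ?_)
  · refine alternatingGroup_le_of_forall_threeCycleLinked ht htG fun x y => ?_
    have hx : x ∈ {x | ThreeCycleLinked G p x} := huniv ▸ _root_.Set.mem_univ x
    have hy : y ∈ {x | ThreeCycleLinked G p x} := huniv ▸ _root_.Set.mem_univ y
    exact hx.symm.trans hy
  · rcases ht.eq_or_eq_or_eq hp hx with rfl | rfl | rfl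
    · exact .refl _
    · exact ⟨t, htG, .inr ht, rfl⟩
    · exact .trans ⟨t, htG, .inr ht, rfl⟩ ⟨t, htG, .inr ht, rfl⟩
  · exact hgq.trans ((hq.map hg).symm.trans (hx.map hg))

/-- A permutation group containing a transposition whose support is contained in no proper block
is the symmetric group. -/
theorem eq_top_of_swap_mem_of_block {G : Subgroup (Perm X)} {a b : X} (htG : swap a b ∈ G)
    (hG : ∀ C : Set X, (∀ x, swap a b x ≠ x → x ∈ C) →
      (∀ g ∈ G, ∀ p ∈ C, g p ∈ C → ∀ x ∈ C, g x ∈ C) → C = _root_.Set.univ) :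
    G = ⊤ := by
  have map : ∀ {g x y}, g ∈ G → swap x y ∈ G → swap (g x) (g y) ∈ G := fun {g x y} hg h => by
    have := mul_mem (mul_mem hg h) (inv_mem hg)
    rwa [← Equiv.swap_apply_apply] at this
  have huniv := hG {x | swap a x ∈ G} (fun x hx => ?_) (fun g hg q hq hgq x hx => ?_)
  · rw [eq_top_iff, ← closure_isSwap, Subgroup.closure_le]
    rintro _ ⟨x, y, -, rfl⟩
    have hx : x ∈ {x | swap a x ∈ G} := huniv ▸ _root_.Set.mem_univ x
    have hy : y ∈ {x | swap a x ∈ G} := huniv ▸ _root_.Set.mem_univ y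
    exact SubmonoidClass.swap_mem_trans G (by rw [swap_comm]; exact hx) hy
  · rcases (swap_apply_ne_self_iff.1 hx).2 with rfl | rfl
    · show swap x x ∈ G
      rw [swap_self]
      exact one_mem G
    · exact htG
  · have h1 : swap (g q) (g x) ∈ G :=
      SubmonoidClass.swap_mem_trans G (by rw [swap_comm]; exact map hg hq) (map hg hx)
    exact SubmonoidClass.swap_mem_trans G hgq h1

theorem eq_top_of_alternatingGroup_le {G : Subgroup (Perm X)} (hG : alternatingGroup X ≤ G)
    {g : Perm X} (hg : g ∈ G) (hs : sign g = -1) : G = ⊤ := by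
  refine eq_top_iff.2 fun h _ => ?_
  rcases Int.units_eq_one_or (sign h) with e | e
  · exact hG (mem_alternatingGroup.2 e)
  · have : h * g⁻¹ ∈ G := hG (mem_alternatingGroup.2 (by simp [e, hs]))
    simpa using mul_mem this hg

end Jordan

end Equiv.Perm

open Equiv Equiv.Perm

/-! ### Instructions on a register, and their signs -/

section Registers

variable {ι A : Type*} [DecidableEq ι]

/-- The values of all registers except the `j`-th one. -/
def otherRegisters (j : ι) (x : ι → A) : {i // i ≠ j} → A := fun i => x i

theorem otherRegisters_update (j : ι) (x : ι → A) (a : A) :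
    otherRegisters j (Function.update x j a) = otherRegisters j x := by
  ext i
  simp [otherRegisters, Function.update_of_ne i.2]

/-- The instruction that applies to the `j`-th register a permutation depending on the values of
the other registers. -/
def instruction (j : ι) : (({i // i ≠ j} → A) → Perm A) →* Perm (ι → A) where
  toFun f :=
    { toFun := fun x => Function.update x j (f (otherRegisters j x) (x j))
      invFun := fun x => Function.update x j ((f (otherRegisters j x)).symm (x j))
      left_inv := fun x => by simp [otherRegisters_update]
      right_inv := fun x => by simp [otherRegisters_update] }
  map_one' := by ext x; simp
  map_mul' f g := by
    ext x : 1
    simp [otherRegisters_update]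

theorem instruction_apply (j : ι) (f : ({i // i ≠ j} → A) → Perm A) (x : ι → A) :
    instruction j f x = Function.update x j (f (otherRegisters j x) (x j)) := rfl

theorem instruction_pow_apply (j : ι) (f : ({i // i ≠ j} → A) → Perm A) (k : ℕ) (x : ι → A) :
    (instruction j f ^ k) x = Function.update x j ((f (otherRegisters j x) ^ k) (x j)) := by
  rw [← map_pow]; rfl

theorem instruction_apply_of_ne (j : ι) (f : ({i // i ≠ j} → A) → Perm A) (x : ι → A) {i : ι}
    (hi : i ≠ j) : instruction j f x i = x i := by
  rw [instruction_apply, Function.update_of_ne hi]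

/-- The state with value `a` in the `j`-th register and values `y` in the other ones. -/
def stateWith (j : ι) (a : A) (y : {i // i ≠ j} → A) : ι → A := (funSplitAt j A).symm (a, y)

theorem stateWith_self (j : ι) (a : A) (y : {i // i ≠ j} → A) : stateWith j a y j = a := by
  simp [stateWith]

theorem stateWith_of_ne (j : ι) (a : A) (y : {i // i ≠ j} → A) {i : ι} (hi : i ≠ j) :
    stateWith j a y i = y ⟨i, hi⟩ := by
  simp [stateWith, hi]

theorem otherRegisters_stateWith (j : ι) (a : A) (y : {i // i ≠ j} → A) :
    otherRegisters j (stateWith j a y) = y := by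
  ext i
  exact stateWith_of_ne j a y i.2

theorem update_stateWith (j : ι) (a b : A) (y : {i // i ≠ j} → A) :
    Function.update (stateWith j a y) j b = stateWith j b y := by
  ext i
  by_cases hi : i = j
  · subst hi; simp [stateWith_self]
  · simp [Function.update_of_ne hi, stateWith_of_ne _ _ _ hi]

theorem stateWith_otherRegisters (j : ι) (x : ι → A) :
    stateWith j (x j) (otherRegisters j x) = x := by
  ext i
  by_cases hi : i = j
  · subst hi; simp [stateWith_self]
  · simp [stateWith_of_ne _ _ _ hi, otherRegisters]

theorem stateWith_inj {j : ι} {a b : A} {y z : {i // i ≠ j} → A} :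
    stateWith j a y = stateWith j b z ↔ a = b ∧ y = z := by
  simp [stateWith]

theorem instruction_stateWith (j : ι) (f : ({i // i ≠ j} → A) → Perm A) (a : A)
    (y : {i // i ≠ j} → A) : instruction j f (stateWith j a y) = stateWith j (f y a) y := by
  rw [instruction_apply, otherRegisters_stateWith, stateWith_self, update_stateWith]

theorem instruction_pow_stateWith (j : ι) (f : ({i // i ≠ j} → A) → Perm A) (k : ℕ) (a : A)
    (y : {i // i ≠ j} → A) :
    (instruction j f ^ k) (stateWith j a y) = stateWith j ((f y ^ k) a) y := by
  rw [← map_pow, instruction_stateWith]; rfl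

/-- The states split into fibres indexed by the values `y` of the other registers, and the
instruction acts as `f y` on each. -/
theorem sign_instruction [Fintype ι] [Fintype A] [DecidableEq A] (j : ι)
    (f : ({i // i ≠ j} → A) → Perm A) : sign (instruction j f) = ∏ y, sign (f y) := by
  rw [← sign_prodCongrRight]
  refine sign_eq_sign_of_equiv _ _ ((funSplitAt j A).trans (prodComm _ _)) fun x => ?_
  refine Prod.ext ?_ ?_
  · exact otherRegisters_update j x _
  · simp [instruction_apply]
    rfl

/-- If the permutation applied depends on one register only, then the sign is a power. -/
theorem sign_instruction_of_apply [Fintype ι] [Fintype A] [DecidableEq A] {i j : ι} (hij : i ≠ j)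
    (φ : A → Perm A) (hφ : ∏ a, sign (φ a) = 1) :
    sign (instruction j fun y => φ (y ⟨i, hij⟩)) = 1 := by
  rw [sign_instruction,
    Fintype.prod_equiv (funSplitAt (⟨i, hij⟩ : {i // i ≠ j}) A) _ (fun p => sign (φ p.1))
      (fun y => by simp), Fintype.prod_prod_type_right]
  simp [hφ]

theorem instruction_mulSingle_swap [DecidableEq A] [Fintype ι] (j : ι) (y : {i // i ≠ j} → A)
    (a b : A) :
    instruction j (Pi.mulSingle y (swap a b)) = swap (stateWith j a y) (stateWith j b y) := by
  ext x : 1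
  obtain ⟨c, z, rfl⟩ : ∃ c z, x = stateWith j c z := ⟨_, _, (stateWith_otherRegisters j x).symm⟩
  rw [instruction_stateWith]
  by_cases hz : z = y
  · subst hz
    rw [Pi.mulSingle_eq_same]
    by_cases ha : c = a
    · subst ha; simp
    by_cases hb : c = b
    · subst hb; simp
    · rw [swap_apply_of_ne_of_ne ha hb, swap_apply_of_ne_of_ne] <;> simp [stateWith_inj, ha, hb]
  · rw [Pi.mulSingle_eq_of_ne hz, swap_apply_of_ne_of_ne] <;> simp [stateWith_inj, hz]

theorem isThreeCycle_instruction_mulSingle [DecidableEq A] [Fintype A] [Fintype ι] (j : ι)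
    (y : {i // i ≠ j} → A) {a b c : A} (hab : a ≠ b) (hac : a ≠ c) (hbc : b ≠ c) :
    (instruction j (Pi.mulSingle y (swap a b * swap a c))).IsThreeCycle := by
  rw [Pi.mulSingle_mul, map_mul, instruction_mulSingle_swap, instruction_mulSingle_swap]
  apply isThreeCycle_swap_mul_swap_same <;> simp [stateWith_inj, *]

/-- A set of states closed under changing the registers in `J` at will, as long as the
`i₀`-th register has a value in `K`, contains with any such state all those that agree with it
outside `J`. -/
theorem mem_of_forall_update_mem [Finite ι] {C : Set (ι → A)} {i₀ : ι} {K : Set A} {J : Set ι}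
    (hJ : i₀ ∉ J)
    (h : ∀ x ∈ C, x i₀ ∈ K → ∀ j ∈ J, ∀ a, Function.update x j a ∈ C) {x x' : ι → A}
    (hx : x ∈ C) (hxK : x i₀ ∈ K) (hxx' : ∀ i ∉ J, x' i = x i) : x' ∈ C := by
  classical
  have := Fintype.ofFinite ι
  have key : ∀ T : Finset ι, (∀ i ∈ T, i ∈ J) → (fun i => if i ∈ T then x' i else x i) ∈ C := by
    intro T
    induction T using Finset.induction_on with
    | empty => intro _; simpa using hx
    | insert j T hj ih =>
      intro hT
      have h0 : i₀ ∉ T := fun h0 => hJ (hT _ (Finset.mem_insert_of_mem h0))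
      have := h _ (ih fun i hi => hT i (Finset.mem_insert_of_mem hi)) (by simpa [h0] using hxK) j
        (hT j (Finset.mem_insert_self _ _)) (x' j)
      convert this using 1
      ext i
      by_cases hij : i = j
      · subst hij; simp
      · simp [hij]
  have := key {i | i ∈ J} (by simp)
  convert this using 1
  ext i
  by_cases hi : i ∈ J
  · simp [hi]
  · simp [hi, hxx' i hi]

end Registers

/-! ### Spreading a block from the base to all states -/

section Linking

variable {ι A : Type*} [DecidableEq ι] [DecidableEq A]

/-- Apply `s` to the `j`-th register, unless the `i₀`-th register has a value in `B`. -/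
def shiftOff {i₀ : ι} (B : Finset A) (s : Perm A) (j : ι) (hj : i₀ ≠ j) : Perm (ι → A) :=
  instruction j fun y => if y ⟨i₀, hj⟩ ∈ B then 1 else s

theorem shiftOff_pow_apply_of_notMem {i₀ j : ι} (hj : i₀ ≠ j) {B : Finset A} (s : Perm A)
    {x : ι → A} (hx : x i₀ ∉ B) (k : ℕ) :
    (shiftOff B s j hj ^ k) x = Function.update x j ((s ^ k) (x j)) := by
  rw [shiftOff, instruction_pow_apply, if_neg (by exact hx)]

theorem shiftOff_apply_of_mem {i₀ j : ι} (hj : i₀ ≠ j) {B : Finset A} (s : Perm A)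
    {x : ι → A} (hx : x i₀ ∈ B) : shiftOff B s j hj x = x := by
  rw [shiftOff, instruction_apply, if_pos (by exact hx)]
  simp

/-- Conditions under which the instruction given by `π` on the register `i₀`, together with the
instructions `shiftOff B s j`, link all states to the states moved by `π o`. -/
structure IsLinking {i₀ : ι} (B : Finset A) (s : Perm A) (o : {i // i ≠ i₀} → A)
    (π : ({i // i ≠ i₀} → A) → Perm A) : Prop where
  nonempty : B.Nonempty
  exists_pow_eq : ∀ a b, ∃ k : ℕ, (s ^ k) a = b
  of_notMem : ∀ a ∉ B, ∃ a' ∉ B, π o a' ≠ a' ∧ (a = a' ∨ ∃ y ≠ o, ∃ k : ℕ, (π y ^ k) a' = a)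
  base_ne_of_mem : ∀ b ∈ B, π o b ≠ b
  of_mem : ∀ b ∈ B, ∀ y ≠ o, ∃ a ∉ B, ∃ k : ℕ, (π y ^ k) a = b

/-- An element fixing a point of `C` preserves `C`, so everything rests on having enough elements of
`G` that fix one base state. -/
theorem IsLinking.block_eq_univ [Fintype ι] {i₀ : ι} {B : Finset A} {s : Perm A}
    {o : {i // i ≠ i₀} → A} {π : ({i // i ≠ i₀} → A) → Perm A} (hL : IsLinking B s o π)
    {G : Subgroup (Perm (ι → A))} (hπ : instruction i₀ π ∈ G)
    (hs : ∀ j hj, shiftOff (i₀ := i₀) B s j hj ∈ G)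
    (ho : instruction i₀ (Pi.mulSingle o (π o)) ∈ G)
    {C : Set (ι → A)} (hCo : ∀ a, π o a ≠ a → stateWith i₀ a o ∈ C)
    (hC : ∀ g ∈ G, ∀ p ∈ C, g p ∈ C → ∀ x ∈ C, g x ∈ C) : C = Set.univ := by
  obtain ⟨b₀, hb₀⟩ := hL.nonempty
  have hp : stateWith i₀ b₀ o ∈ C := hCo _ (hL.base_ne_of_mem _ hb₀)
  have fix : ∀ g ∈ G, g (stateWith i₀ b₀ o) = stateWith i₀ b₀ o → ∀ k : ℕ, ∀ x ∈ C,
      (g ^ k) x ∈ C := fun g hg hgp k x hx =>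
    hC _ (pow_mem hg k) _ hp (by
      rwa [Function.IsFixedPt.perm_pow hgp]) x hx
  have shift : ∀ x ∈ C, x i₀ ∉ B → ∀ x', x' i₀ = x i₀ → x' ∈ C := by
    intro x hx hxB x' hx'
    refine mem_of_forall_update_mem (i₀ := i₀) (K := {a | a ∉ B}) (J := {i | i ≠ i₀}) (by simp)
      ?_ hx hxB ?_
    · intro x hx hxB j hj a
      obtain ⟨k, hk⟩ := hL.exists_pow_eq (x j) a
      have hj' : i₀ ≠ j := fun e => hj e.symm
      have := fix _ (hs j hj') (shiftOff_apply_of_mem _ _ (by rwa [stateWith_self])) k x hx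
      rwa [shiftOff_pow_apply_of_notMem _ _ hxB, hk] at this
    · intro i hi
      have : i = i₀ := by simpa using hi
      rw [this, hx']
  have link : ∀ y ≠ o, ∀ a, stateWith i₀ a y ∈ C → ∀ k : ℕ, stateWith i₀ ((π y ^ k) a) y ∈ C := by
    intro y hy a ha k
    -- Dividing out `π o` leaves an instruction that is trivial at `o`, hence fixes the base state,
    -- and still acts as `π y` for `y ≠ o`.
    have hmem : instruction i₀ (π * (Pi.mulSingle o (π o))⁻¹) ∈ G := by
      rw [map_mul, map_inv]
      exact mul_mem hπ (inv_mem ho)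
    have := fix _ hmem (by rw [instruction_stateWith]; simp) k _ ha
    rw [instruction_pow_stateWith] at this
    simpa [Pi.mulSingle_eq_of_ne hy] using this
  -- Shift from the support of `π o` to a suitable `y'`, change the value `a'` into `a` by `π y'`,
  -- and shift again to reach any `y`.
  have free : ∀ a ∉ B, ∀ y, stateWith i₀ a y ∈ C := by
    intro a ha y
    obtain ⟨a', ha', hne, h⟩ := hL.of_notMem a ha
    have h' : ∀ y', stateWith i₀ a' y' ∈ C := fun y' =>
      shift _ (hCo _ hne) (by rwa [stateWith_self]) _ (by simp only [stateWith_self])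
    rcases h with rfl | ⟨y', hy', k, rfl⟩
    · exact h' y
    · exact shift _ (link y' hy' _ (h' y') k) (by rwa [stateWith_self]) _
        (by simp only [stateWith_self])
  refine Set.eq_univ_of_forall fun x => ?_
  rw [← stateWith_otherRegisters i₀ x]
  by_cases hx : x i₀ ∈ B
  · by_cases hy : otherRegisters i₀ x = o
    · rw [hy]
      exact hCo _ (hL.base_ne_of_mem _ hx)
    · obtain ⟨a, ha, k, hk⟩ := hL.of_mem _ hx _ hy
      rw [← hk]
      exact link _ hy _ (free a ha _) k
  · exact free _ hx _

end Linking

/-! ### Generating families and parity -/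

section Generators

variable {A : Type*} {n : ℕ}

theorem updatesOnly_instruction (j : Fin n) (f : ({i // i ≠ j} → A) → Perm A) :
    UpdatesOnly (instruction j f) j :=
  fun x _ hi => instruction_apply_of_ne j f x hi

theorem UpdatesOnly.eq_one {g : Perm (Fin n → A)} {i j : Fin n} (hi : UpdatesOnly g i)
    (hj : UpdatesOnly g j) (hij : i ≠ j) : g = 1 := by
  ext x k
  by_cases hk : k = i
  · exact hj x k (hk ▸ hij)
  · exact hi x k hk

/-- A family of nontrivial instructions, one for each register, has as many elements as there
are registers. -/
theorem exists_finset_of_forall_updatesOnly [Fintype A] [DecidableEq A]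
    (g : Fin n → Perm (Fin n → A))
    (hg : ∀ j, UpdatesOnly (g j) j) (hne : ∀ j, g j ≠ 1) :
    ∃ S : Finset (Perm (Fin n → A)), S.card = n ∧ (∀ g ∈ S, IsInstruction g) ∧
      (S : Set (Perm (Fin n → A))) = Set.range g := by
  refine ⟨Finset.univ.image g, ?_, ?_, by simp⟩
  · rw [Finset.card_image_of_injective, Finset.card_univ, Fintype.card_fin]
    intro i j hij
    by_contra h
    exact hne i ((hg i).eq_one (hij ▸ hg j) h)
  · simp only [Finset.mem_image, Finset.mem_univ, true_and, forall_exists_index]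
    rintro _ j rfl
    exact ⟨j, hg j⟩

variable [DecidableEq A]

/-- The instruction given by `π` on the register `i₀` and `shiftOff B s j` on the others. -/
def linkingFamily (i₀ : Fin n) (B : Finset A) (s : Perm A)
    (π : ({i // i ≠ i₀} → A) → Perm A) (j : Fin n) : Perm (Fin n → A) :=
  if hj : i₀ = j then instruction i₀ π else shiftOff B s j hj

theorem updatesOnly_linkingFamily (i₀ : Fin n) (B : Finset A) (s : Perm A)
    (π : ({i // i ≠ i₀} → A) → Perm A) (j : Fin n) :
    UpdatesOnly (linkingFamily i₀ B s π j) j := by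
  unfold linkingFamily
  split_ifs with h
  · subst h
    exact updatesOnly_instruction _ _
  · exact updatesOnly_instruction _ _

variable {i₀ : Fin n} {B : Finset A} {s : Perm A} {o : {i // i ≠ i₀} → A}
  {π : ({i // i ≠ i₀} → A) → Perm A}

theorem IsLinking.linkingFamily_ne_one (hL : IsLinking B s o π) {a : A} (ha : a ∉ B) (j : Fin n) :
    linkingFamily i₀ B s π j ≠ 1 := by
  obtain ⟨b, hb⟩ := hL.nonempty
  intro h
  by_cases hj : i₀ = j
  · rw [linkingFamily, dif_pos hj] at h
    have := DFunLike.congr_fun h (stateWith i₀ b o)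
    rw [instruction_stateWith, Perm.one_apply, stateWith_inj] at this
    exact hL.base_ne_of_mem b hb this.1
  · rw [linkingFamily, dif_neg hj] at h
    obtain ⟨k, hk⟩ := hL.exists_pow_eq a b
    have h1 := shiftOff_pow_apply_of_notMem hj s (x := fun _ => a) ha k
    rw [h, one_pow, Perm.one_apply, hk] at h1
    have h2 := congrFun h1 j
    rw [Function.update_self] at h2
    exact ha (h2 ▸ hb)

/-- The power of `instruction i₀ π` that isolates the permutation `π o`. -/
theorem instruction_pow_eq_mulSingle {N : ℕ} (ho : π o ^ N = π o) (hN : ∀ y ≠ o, π y ^ N = 1) :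
    instruction i₀ π ^ N = instruction i₀ (Pi.mulSingle o (π o)) := by
  rw [← map_pow]
  congr 1
  funext y
  by_cases hy : y = o
  · subst hy; simpa using ho
  · simpa [Pi.mulSingle_eq_of_ne hy] using hN y hy

theorem instruction_mem_closure_linkingFamily :
    instruction i₀ π ∈ Subgroup.closure (Set.range (linkingFamily i₀ B s π)) :=
  Subgroup.subset_closure ⟨i₀, by simp [linkingFamily]⟩

theorem shiftOff_mem_closure_linkingFamily (j : Fin n) (hj : i₀ ≠ j) :
    shiftOff B s j hj ∈ Subgroup.closure (Set.range (linkingFamily i₀ B s π)) :=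
  Subgroup.subset_closure ⟨j, by simp [linkingFamily, hj]⟩

variable [Fintype A]

theorem IsLinking.closure_eq_top (hL : IsLinking B s o π) {N : ℕ} {a b : A} (ho : π o = swap a b)
    (hoN : π o ^ N = π o) (hN : ∀ y ≠ o, π y ^ N = 1) :
    Subgroup.closure (Set.range (linkingFamily i₀ B s π)) = ⊤ := by
  have hmem : instruction i₀ (Pi.mulSingle o (π o)) ∈
      Subgroup.closure (Set.range (linkingFamily i₀ B s π)) :=
    instruction_pow_eq_mulSingle hoN hN ▸ pow_mem instruction_mem_closure_linkingFamily N
  have hswap := hmem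
  rw [ho, instruction_mulSingle_swap] at hswap
  refine eq_top_of_swap_mem_of_block hswap fun C hC hG => ?_
  refine hL.block_eq_univ instruction_mem_closure_linkingFamily shiftOff_mem_closure_linkingFamily
    hmem (fun c hc => hC _ ?_) hG
  rw [← instruction_mulSingle_swap, instruction_stateWith, ← ho]
  simpa [stateWith_inj] using hc

theorem IsLinking.alternatingGroup_le_closure (hL : IsLinking B s o π) {N : ℕ} {a b c : A}
    (hab : a ≠ b) (hac : a ≠ c) (hbc : b ≠ c) (ho : π o = swap a b * swap a c)
    (hoN : π o ^ N = π o) (hN : ∀ y ≠ o, π y ^ N = 1) :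
    alternatingGroup (Fin n → A) ≤ Subgroup.closure (Set.range (linkingFamily i₀ B s π)) := by
  have hmem : instruction i₀ (Pi.mulSingle o (π o)) ∈
      Subgroup.closure (Set.range (linkingFamily i₀ B s π)) :=
    instruction_pow_eq_mulSingle hoN hN ▸ pow_mem instruction_mem_closure_linkingFamily N
  refine alternatingGroup_le_of_isThreeCycle_of_block
    (ho ▸ isThreeCycle_instruction_mulSingle i₀ o hab hac hbc) hmem fun C hC hG => ?_
  refine hL.block_eq_univ instruction_mem_closure_linkingFamily shiftOff_mem_closure_linkingFamily
    hmem (fun c hc => hC _ ?_) hG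
  rw [instruction_stateWith]
  simpa [stateWith_inj] using hc

/-- The permutation `s` is used for `q - |B|` values of the register `i₀`, so its signs cancel. -/
theorem sign_shiftOff_eq_one {j : Fin n} (hj : i₀ ≠ j) (hB : Even (Fintype.card A - B.card)) :
    sign (shiftOff B s j hj) = 1 := by
  refine sign_instruction_of_apply hj (fun a => if a ∈ B then 1 else s) ?_
  have : ∀ a, sign (if a ∈ B then 1 else s) = if a ∈ B then 1 else sign s := fun a => by
    split_ifs <;> simp
  simp only [this, Finset.prod_ite, Finset.prod_const_one, one_mul, Finset.prod_const]
  have hc : (Finset.univ.filter (· ∉ B)).card = Fintype.card A - B.card := by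
    rw [← Finset.card_compl]
    congr 1
    ext; simp
  rw [hc]
  rcases Int.units_eq_one_or (sign s) with e | e <;> simp [e, hB.neg_one_pow]

theorem sign_instruction_eq_neg_one_pow {P : Finset ({i // i ≠ i₀} → A)}
    (hπ : ∀ y, sign (π y) = if y ∈ P then 1 else -1) :
    sign (instruction i₀ π) = (-1) ^ (Fintype.card A ^ (n - 1) - P.card) := by
  rw [sign_instruction]
  simp only [hπ, Finset.prod_ite, Finset.prod_const_one, one_mul, Finset.prod_const]
  have hc : (Finset.univ.filter (· ∉ P)).card = Fintype.card A ^ (n - 1) - P.card := by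
    have : Fintype.card ({i // i ≠ i₀} → A) = Fintype.card A ^ (n - 1) := by simp
    rw [← this, ← Finset.card_compl]
    congr 1
    ext; simp
  rw [hc]

theorem IsLinking.closure_eq_alternatingGroup (hL : IsLinking B s o π) {N : ℕ} {a b c : A}
    (hab : a ≠ b) (hac : a ≠ c) (hbc : b ≠ c) (ho : π o = swap a b * swap a c)
    (hoN : π o ^ N = π o) (hN : ∀ y ≠ o, π y ^ N = 1) {P : Finset ({i // i ≠ i₀} → A)}
    (hπ : ∀ y, sign (π y) = if y ∈ P then 1 else -1)
    (hP : Even (Fintype.card A ^ (n - 1) - P.card)) (hB : Even (Fintype.card A - B.card)) :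
    Subgroup.closure (Set.range (linkingFamily i₀ B s π)) = alternatingGroup (Fin n → A) := by
  refine le_antisymm ?_ (hL.alternatingGroup_le_closure hab hac hbc ho hoN hN)
  rw [Subgroup.closure_le]
  rintro _ ⟨j, rfl⟩
  refine mem_alternatingGroup.2 ?_
  unfold linkingFamily
  split_ifs with h
  · rw [sign_instruction_eq_neg_one_pow hπ, hP.neg_one_pow]
  · exact sign_shiftOff_eq_one h hB

theorem exists_perm_forall_exists_pow_eq (A : Type*) [Fintype A] [DecidableEq A] :
    ∃ s : Perm A, ∀ a b, ∃ k : ℕ, (s ^ k) a = b := by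
  obtain ⟨s, hs, -⟩ := Finset.exists_cycleOn (Finset.univ : Finset A)
  refine ⟨s, fun a b => ?_⟩
  obtain ⟨k, -, hk⟩ := hs.exists_pow_eq (Finset.mem_univ a) (Finset.mem_univ b)
  exact ⟨k, hk⟩

end Generators

/-! ### Choices of `π` and `B` for `q ≥ 3` -/

section Constructions

variable {A : Type*} [DecidableEq A]

/-- The cycle `a → b → c → d → a`. -/
def fourCycle (a b c d : A) : Perm A := swap a b * swap b c * swap c d

section FourCycle

variable {a b c d : A}

theorem fourCycle_apply_first (hab : a ≠ b) (hac : a ≠ c) (had : a ≠ d) :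
    fourCycle a b c d a = b := by
  simp [fourCycle, swap_apply_of_ne_of_ne, *]

theorem fourCycle_apply_second (hac : a ≠ c) (hbc : b ≠ c) (hbd : b ≠ d) :
    fourCycle a b c d b = c := by
  simp [fourCycle, swap_apply_of_ne_of_ne, hbc, hbd, hac.symm, hbc.symm]

theorem fourCycle_apply_third (had : a ≠ d) (hbd : b ≠ d) (hcd : c ≠ d) :
    fourCycle a b c d c = d := by
  simp [fourCycle, swap_apply_of_ne_of_ne, had.symm, hbd.symm, hcd.symm]

theorem fourCycle_apply_fourth : fourCycle a b c d d = a := by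
  simp [fourCycle]

theorem fourCycle_pow_four (hab : a ≠ b) (hac : a ≠ c) (had : a ≠ d) (hbc : b ≠ c) (hbd : b ≠ d)
    (hcd : c ≠ d) : fourCycle a b c d ^ 4 = 1 := by
  have h1 := fourCycle_apply_first hab hac had
  have h2 := fourCycle_apply_second hac hbc hbd
  have h3 := fourCycle_apply_third had hbd hcd
  have h4 := fourCycle_apply_fourth (a := a) (b := b) (c := c) (d := d)
  ext x
  simp only [pow_succ, pow_zero, one_mul, mul_apply, one_apply]
  by_cases ha : x = a
  · simp [ha, h1, h2, h3, h4]
  by_cases hb : x = b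
  · simp [hb, h1, h2, h3, h4]
  by_cases hc : x = c
  · simp [hc, h1, h2, h3, h4]
  by_cases hd : x = d
  · simp [hd, h1, h2, h3, h4]
  have : fourCycle a b c d x = x := by
    simp [fourCycle, swap_apply_of_ne_of_ne, *]
  simp [this]

theorem sign_fourCycle [Fintype A] (hab : a ≠ b) (hbc : b ≠ c) (hcd : c ≠ d) :
    sign (fourCycle a b c d) = -1 := by
  simp [fourCycle, *]

end FourCycle

variable [Fintype A] {n : ℕ}

theorem swap_mul_swap_same_pow_four {a b c : A} (hab : a ≠ b) (hac : a ≠ c) (hbc : b ≠ c) :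
    (swap a b * swap a c) ^ 4 = swap a b * swap a c := by
  rw [pow_succ, (isThreeCycle_swap_mul_swap_same hab hac hbc).pow_three, one_mul]

/-- A transposition at `o` and three-cycles elsewhere are separated by cubing. -/
theorem exists_linkingFamily_closure_eq_top (hq : 3 ≤ Fintype.card A) {i₀ j₁ : Fin n}
    (h : j₁ ≠ i₀) : ∃ g : Fin n → Perm (Fin n → A), (∀ j, UpdatesOnly (g j) j) ∧ (∀ j, g j ≠ 1) ∧
      Subgroup.closure (Set.range g) = ⊤ := by
  obtain ⟨a, b, c, hab, hac, hbc⟩ := Fintype.two_lt_card_iff.1 hq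
  obtain ⟨s, hs⟩ := exists_perm_forall_exists_pow_eq A
  -- On the constant `y = d` with `d ≠ a, b` this is `d`, so the cycles `a → b → κ y → a` together
  -- carry `a` to every value.
  let κ : ({i // i ≠ i₀} → A) → A := fun y =>
    if y ⟨j₁, h⟩ = a ∨ y ⟨j₁, h⟩ = b then c else y ⟨j₁, h⟩
  have hκa : ∀ y, κ y ≠ a := fun y => by grind
  have hκb : ∀ y, κ y ≠ b := fun y => by grind
  let o : {i // i ≠ i₀} → A := fun _ => a
  let π : ({i // i ≠ i₀} → A) → Perm A := fun y =>
    if y = o then swap a b else swap b a * swap b (κ y)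
  have hπo : π o = swap a b := if_pos rfl
  have hπ : ∀ y ≠ o, π y = swap b a * swap b (κ y) := fun y hy => if_neg hy
  have hπa : ∀ y ≠ o, π y a = b := fun y hy => by
    rw [hπ y hy, mul_apply, swap_apply_of_ne_of_ne hab (hκa y).symm, swap_apply_right]
  have hπb : ∀ y ≠ o, π y b = κ y := fun y hy => by
    rw [hπ y hy, mul_apply, swap_apply_left, swap_apply_of_ne_of_ne (hκb y) (hκa y)]
  have hL : IsLinking {b} s o π := by
    refine ⟨by simp, hs, fun d hd => ?_, fun d hd => ?_, fun d hd y hy => ?_⟩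
    · rw [Finset.mem_singleton] at hd
      refine ⟨a, by simpa using hab, by simpa [hπo] using hab.symm, ?_⟩
      by_cases hda : d = a
      · exact .inl hda
      have hy : (fun _ => d : {i // i ≠ i₀} → A) ≠ o := fun e => hda (congrFun e ⟨j₁, h⟩)
      refine .inr ⟨_, hy, 2, ?_⟩
      rw [pow_two, mul_apply, hπa _ hy, hπb _ hy]
      simp [κ, hda, hd]
    · rw [Finset.mem_singleton] at hd
      rw [hπo, hd, swap_apply_right]
      exact hab
    · rw [Finset.mem_singleton] at hd
      exact ⟨a, by simpa using hab, 1, by rw [pow_one, hπa y hy, hd]⟩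
  refine ⟨linkingFamily i₀ {b} s π, updatesOnly_linkingFamily _ _ _ _,
    hL.linkingFamily_ne_one (a := a) (by simpa using hab),
    hL.closure_eq_top (N := 3) hπo ?_ fun y hy => ?_⟩
  · rw [hπo, pow_succ, pow_two, swap_mul_self, one_mul]
  · rw [hπ y hy]
    exact (isThreeCycle_swap_mul_swap_same hab.symm (hκb y).symm (hκa y).symm).pow_three

/-- The three-cycle at `o` already moves every value. The fourth power keeps it and kills the
transpositions elsewhere, of which there are `3 ^ (n - 1) - 1`, an even number. -/
theorem exists_linkingFamily_closure_eq_alternatingGroup_of_card_eq_three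
    (hq : Fintype.card A = 3) (i₀ : Fin n) :
    ∃ g : Fin n → Perm (Fin n → A), (∀ j, UpdatesOnly (g j) j) ∧ (∀ j, g j ≠ 1) ∧
      Subgroup.closure (Set.range g) = alternatingGroup (Fin n → A) := by
  obtain ⟨a, b, c, hab, hac, hbc⟩ := Fintype.two_lt_card_iff.1 hq.ge
  obtain ⟨s, hs⟩ := exists_perm_forall_exists_pow_eq A
  have hA : ∀ d, d = a ∨ d = b ∨ d = c := fun d => by
    have : d ∈ ({a, b, c} : Finset A) := by
      rw [Finset.eq_univ_of_card {a, b, c} (by rw [hq, Finset.card_eq_three.2 ⟨a, b, c, hab, hac, hbc, rfl⟩])]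
      exact Finset.mem_univ d
    simpa using this
  let o : {i // i ≠ i₀} → A := fun _ => a
  let π : ({i // i ≠ i₀} → A) → Perm A := fun y => if y = o then swap a b * swap a c else swap a b
  have hπo : π o = swap a b * swap a c := if_pos rfl
  have hπ : ∀ y ≠ o, π y = swap a b := fun y hy => if_neg hy
  have hoa : π o a = c := by
    rw [hπo, mul_apply, swap_apply_left, swap_apply_of_ne_of_ne hac.symm hbc.symm]
  have hob : π o b = a := by
    rw [hπo, mul_apply, swap_apply_of_ne_of_ne hab.symm hbc, swap_apply_right]
  have hoc : π o c = b := by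
    rw [hπo, mul_apply, swap_apply_right, swap_apply_left]
  have hL : IsLinking {b} s o π := by
    refine ⟨by simp, hs, fun d hd => ⟨d, hd, ?_, .inl rfl⟩, fun d hd => ?_, fun d hd y hy => ?_⟩
    · rcases hA d with rfl | rfl | rfl
      · rw [hoa]; exact hac.symm
      · rw [hob]; exact hab
      · rw [hoc]; exact hbc
    · rw [Finset.mem_singleton.1 hd, hob]
      exact hab
    · rw [Finset.mem_singleton.1 hd]
      exact ⟨a, by simpa using hab, 1, by rw [hπ y hy, pow_one, swap_apply_left]⟩
  refine ⟨linkingFamily i₀ {b} s π, updatesOnly_linkingFamily _ _ _ _,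
    hL.linkingFamily_ne_one (a := a) (by simpa using hab),
    hL.closure_eq_alternatingGroup (N := 4) (P := {o}) hab hac hbc hπo ?_ (fun y hy => ?_)
      (fun y => ?_) ?_ ?_⟩
  · rw [hπo, swap_mul_swap_same_pow_four hab hac hbc]
  · rw [hπ y hy, pow_succ, pow_succ, pow_two, swap_mul_self, one_mul, swap_mul_self]
  · by_cases hy : y = o
    · simp [*]
    · simp [hy, hπ y hy, hab]
  · rw [hq, Finset.card_singleton]
    exact Nat.Odd.sub_odd (Odd.pow (by decide)) odd_one
  · rw [hq, Finset.card_singleton]; decide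

/-- Four-cycles `a → b → c → κ y → a` away from `o` are killed by the fourth power, which keeps the
three-cycle at `o`. They are odd, but `q ^ (n - 1) - 1` of them make an even instruction. -/
theorem exists_linkingFamily_closure_eq_alternatingGroup_of_odd (hq : 3 < Fintype.card A)
    (hodd : Odd (Fintype.card A)) {i₀ j₁ : Fin n} (h : j₁ ≠ i₀) :
    ∃ g : Fin n → Perm (Fin n → A), (∀ j, UpdatesOnly (g j) j) ∧ (∀ j, g j ≠ 1) ∧
      Subgroup.closure (Set.range g) = alternatingGroup (Fin n → A) := by
  obtain ⟨a, b, c, hab, hac, hbc⟩ := Fintype.two_lt_card_iff.1 hq.le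
  obtain ⟨e, he⟩ : ∃ e, e ∉ ({a, b, c} : Finset A) := by
    by_contra! hall
    have := Finset.card_le_card (fun x _ => hall x : Finset.univ ⊆ {a, b, c})
    have := this.trans Finset.card_le_three
    rw [Finset.card_univ] at this
    omega
  obtain ⟨s, hs⟩ := exists_perm_forall_exists_pow_eq A
  let κ : ({i // i ≠ i₀} → A) → A := fun y =>
    if y ⟨j₁, h⟩ ∈ ({a, b, c} : Finset A) then e else y ⟨j₁, h⟩
  have hκa : ∀ y, a ≠ κ y := fun y => by grind
  have hκb : ∀ y, b ≠ κ y := fun y => by grind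
  have hκc : ∀ y, c ≠ κ y := fun y => by grind
  let o : {i // i ≠ i₀} → A := fun _ => a
  let π : ({i // i ≠ i₀} → A) → Perm A := fun y =>
    if y = o then swap a b * swap a c else fourCycle a b c (κ y)
  have hπo : π o = swap a b * swap a c := if_pos rfl
  have hπ : ∀ y ≠ o, π y = fourCycle a b c (κ y) := fun y hy => if_neg hy
  have hπa : ∀ y ≠ o, π y a = b := fun y hy => by
    rw [hπ y hy, fourCycle_apply_first hab hac (hκa y)]
  have hπb : ∀ y ≠ o, π y b = c := fun y hy => by
    rw [hπ y hy, fourCycle_apply_second hac hbc (hκb y)]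
  have hπc : ∀ y ≠ o, π y c = κ y := fun y hy => by
    rw [hπ y hy, fourCycle_apply_third (hκa y) (hκb y) (hκc y)]
  have hoa : π o a = c := by
    rw [hπo, mul_apply, swap_apply_left, swap_apply_of_ne_of_ne hac.symm hbc.symm]
  have hob : π o b = a := by
    rw [hπo, mul_apply, swap_apply_of_ne_of_ne hab.symm hbc, swap_apply_right]
  have hL : IsLinking {b} s o π := by
    refine ⟨by simp, hs, fun d hd => ?_, fun d hd => ?_, fun d hd y hy => ?_⟩
    · rw [Finset.mem_singleton] at hd
      refine ⟨a, by simpa using hab, by rw [hoa]; exact hac.symm, ?_⟩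
      by_cases hda : d = a
      · exact .inl hda
      have hy : (fun _ => d : {i // i ≠ i₀} → A) ≠ o := fun e => hda (congrFun e ⟨j₁, h⟩)
      refine .inr ⟨_, hy, ?_⟩
      by_cases hdc : d = c
      · exact ⟨2, by rw [pow_two, mul_apply, hπa _ hy, hπb _ hy, hdc]⟩
      · refine ⟨3, ?_⟩
        rw [pow_succ, pow_two, mul_apply, mul_apply, hπa _ hy, hπb _ hy, hπc _ hy]
        simp [κ, hda, hd, hdc]
    · rw [Finset.mem_singleton.1 hd, hob]
      exact hab
    · rw [Finset.mem_singleton.1 hd]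
      exact ⟨a, by simpa using hab, 1, by rw [pow_one, hπa y hy]⟩
  refine ⟨linkingFamily i₀ {b} s π, updatesOnly_linkingFamily _ _ _ _,
    hL.linkingFamily_ne_one (a := a) (by simpa using hab),
    hL.closure_eq_alternatingGroup (N := 4) (P := {o}) hab hac hbc hπo ?_ (fun y hy => ?_)
      (fun y => ?_) ?_ ?_⟩
  · rw [hπo, swap_mul_swap_same_pow_four hab hac hbc]
  · rw [hπ y hy, fourCycle_pow_four hab hac (hκa y) hbc (hκb y) (hκc y)]
  · by_cases hy : y = o
    · simp [*]
    · simp [hy, hπ y hy, sign_fourCycle hab hbc (hκc y)]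
  · rw [Finset.card_singleton]
    exact Nat.Odd.sub_odd hodd.pow odd_one
  · rw [Finset.card_singleton]
    exact Nat.Odd.sub_odd hodd odd_one

/-- For even `q` both parities of the odd case fail by one. They are repaired by a second place `o'`
where `π` is even, a double transposition, and by a second element of `B`. -/
theorem exists_linkingFamily_closure_eq_alternatingGroup_of_even (hq : 3 < Fintype.card A)
    (heven : Even (Fintype.card A)) (hn : 2 ≤ n) {i₀ j₁ : Fin n} (h : j₁ ≠ i₀) :
    ∃ g : Fin n → Perm (Fin n → A), (∀ j, UpdatesOnly (g j) j) ∧ (∀ j, g j ≠ 1) ∧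
      Subgroup.closure (Set.range g) = alternatingGroup (Fin n → A) := by
  obtain ⟨a, b, c, hab, hac, hbc⟩ := Fintype.two_lt_card_iff.1 hq.le
  obtain ⟨e, he⟩ : ∃ e, e ∉ ({a, b, c} : Finset A) := by
    by_contra! hall
    have := Finset.card_le_card (fun x _ => hall x : Finset.univ ⊆ {a, b, c})
    have := this.trans Finset.card_le_three
    rw [Finset.card_univ] at this
    omega
  have hea : a ≠ e := by grind
  have heb : b ≠ e := by grind
  have hec : c ≠ e := by grind
  obtain ⟨s, hs⟩ := exists_perm_forall_exists_pow_eq A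
  let κ : ({i // i ≠ i₀} → A) → A := fun y =>
    if y ⟨j₁, h⟩ ∈ ({a, b, c} : Finset A) then e else y ⟨j₁, h⟩
  have hκa : ∀ y, a ≠ κ y := fun y => by grind
  have hκb : ∀ y, b ≠ κ y := fun y => by grind
  have hκc : ∀ y, c ≠ κ y := fun y => by grind
  let o : {i // i ≠ i₀} → A := fun _ => a
  -- The constant `b` is never needed to reach a value: the constants `d` used for that lie outside
  -- `B = {b, c}`.
  let o' : {i // i ≠ i₀} → A := fun _ => b
  have hoo' : o' ≠ o := fun h' => hab (congrFun h' ⟨j₁, h⟩).symm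
  let π : ({i // i ≠ i₀} → A) → Perm A := fun y =>
    if y = o then swap a b * swap a c
    else if y = o' then swap a b * swap c e else fourCycle a b c (κ y)
  have hπo : π o = swap a b * swap a c := if_pos rfl
  have hπo' : π o' = swap a b * swap c e := by simp [π, hoo']
  have hπ : ∀ y, y ≠ o → y ≠ o' → π y = fourCycle a b c (κ y) := fun y hy hy' => by
    simp [π, hy, hy']
  have hπa : ∀ y ≠ o, π y a = b := fun y hy => by
    by_cases hy' : y = o'
    · rw [hy', hπo', mul_apply, swap_apply_of_ne_of_ne hac hea, swap_apply_left]
    · rw [hπ y hy hy', fourCycle_apply_first hab hac (hκa y)]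
  have hπb : ∀ y, y ≠ o → y ≠ o' → π y b = c := fun y hy hy' => by
    rw [hπ y hy hy', fourCycle_apply_second hac hbc (hκb y)]
  have hπc : ∀ y, y ≠ o → y ≠ o' → π y c = κ y := fun y hy hy' => by
    rw [hπ y hy hy', fourCycle_apply_third (hκa y) (hκb y) (hκc y)]
  have hoa : π o a = c := by
    rw [hπo, mul_apply, swap_apply_left, swap_apply_of_ne_of_ne hac.symm hbc.symm]
  have hob : π o b = a := by
    rw [hπo, mul_apply, swap_apply_of_ne_of_ne hab.symm hbc, swap_apply_right]
  have hoc : π o c = b := by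
    rw [hπo, mul_apply, swap_apply_right, swap_apply_left]
  have haB : a ∉ ({b, c} : Finset A) := by simp [hab, hac]
  have hL : IsLinking {b, c} s o π := by
    refine ⟨by simp, hs, fun d hd => ?_, fun d hd => ?_, fun d hd y hy => ?_⟩
    · simp only [Finset.mem_insert, Finset.mem_singleton, not_or] at hd
      refine ⟨a, haB, by rw [hoa]; exact hac.symm, ?_⟩
      by_cases hda : d = a
      · exact .inl hda
      have hy : (fun _ => d : {i // i ≠ i₀} → A) ≠ o := fun e => hda (congrFun e ⟨j₁, h⟩)
      have hy' : (fun _ => d : {i // i ≠ i₀} → A) ≠ o' := fun e => hd.1 (congrFun e ⟨j₁, h⟩)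
      refine .inr ⟨_, hy, 3, ?_⟩
      rw [pow_succ, pow_two, mul_apply, mul_apply, hπa _ hy, hπb _ hy hy', hπc _ hy hy']
      simp [κ, hda, hd]
    · rw [Finset.mem_insert, Finset.mem_singleton] at hd
      rcases hd with rfl | rfl
      · rw [hob]; exact hab
      · rw [hoc]; exact hbc
    · rw [Finset.mem_insert, Finset.mem_singleton] at hd
      rcases hd with rfl | rfl
      · exact ⟨a, haB, 1, by rw [pow_one, hπa y hy]⟩
      · by_cases hy' : y = o'
        · refine ⟨e, by simp [heb.symm, hec.symm], 1, ?_⟩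
          rw [pow_one, hy', hπo', mul_apply, swap_apply_right,
            swap_apply_of_ne_of_ne hac.symm hbc.symm]
        · exact ⟨a, haB, 2, by rw [pow_two, mul_apply, hπa y hy, hπb y hy hy']⟩
  refine ⟨linkingFamily i₀ {b, c} s π, updatesOnly_linkingFamily _ _ _ _,
    hL.linkingFamily_ne_one haB,
    hL.closure_eq_alternatingGroup (N := 4) (P := {o, o'}) hab hac hbc hπo ?_ (fun y hy => ?_)
      (fun y => ?_) ?_ ?_⟩
  · rw [hπo, swap_mul_swap_same_pow_four hab hac hbc]
  · by_cases hy' : y = o'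
    · have hcomm : Commute (swap a b) (swap c e) :=
        (Perm.disjoint_swap_swap (by simp [*])).commute
      have hsq : ∀ x z : A, swap x z ^ 4 = 1 := fun x z => by
        rw [pow_succ, pow_succ, pow_two, swap_mul_self, one_mul, swap_mul_self]
      rw [hy', hπo', hcomm.mul_pow, hsq, hsq, one_mul]
    · rw [hπ y hy hy', fourCycle_pow_four hab hac (hκa y) hbc (hκb y) (hκc y)]
  · by_cases hy : y = o
    · simp [*]
    by_cases hy' : y = o'
    · simp [*]
    · simp [hy, hy', hπ y hy hy', sign_fourCycle hab hbc (hκc y)]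
  · rw [Finset.card_pair hoo'.symm]
    exact (heven.pow_of_ne_zero (by omega)).tsub even_two
  · rw [Finset.card_pair hbc]
    exact heven.tsub even_two

end Constructions

/-! ### Two values and at least three registers -/

section Binary

variable {A : Type*} [DecidableEq A] {n : ℕ}

/-- Exchange the values `a` and `b` of the register `i`, unless all other registers have the
value `a`, except for the register `i'`, which has the value `b`. -/
def flipUnless (a b : A) (i i' : Fin n) (h : i' ≠ i) : Perm (Fin n → A) :=
  instruction i fun y => if y = Function.update (fun _ => a) ⟨i', h⟩ b then 1 else swap a b

variable {a b : A} {i i' : Fin n} {h : i' ≠ i} {x : Fin n → A}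

theorem flipUnless_apply_of_apply_ne (hx : x i' ≠ b) :
    flipUnless a b i i' h x = Function.update x i (swap a b (x i)) := by
  rw [flipUnless, instruction_apply, if_neg]
  intro e
  apply hx
  have := congrFun e ⟨i', h⟩
  rwa [Function.update_self] at this

theorem flipUnless_apply_of_exists_ne {k : Fin n} (hki : k ≠ i) (hki' : k ≠ i') (hk : x k ≠ a) :
    flipUnless a b i i' h x = Function.update x i (swap a b (x i)) := by
  rw [flipUnless, instruction_apply, if_neg]
  intro e
  apply hk
  have := congrFun e ⟨k, hki⟩
  rwa [Function.update_of_ne (by simpa using hki')] at this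

theorem flipUnless_apply_eq_self (hx : x i' = b) (hk : ∀ k, k ≠ i → k ≠ i' → x k = a) :
    flipUnless a b i i' h x = x := by
  rw [flipUnless, instruction_apply, if_pos]
  · simp
  · ext ⟨k, hki⟩
    by_cases hki' : k = i'
    · subst hki'; simpa [otherRegisters] using hx
    · rw [Function.update_of_ne (by simpa using hki')]
      exact hk k hki hki'

/-- On the square where all registers but `i` and `i'` equal `a`, the exception suppresses the flip
of one of the two edges in direction `i`; only the edge at the constant state `a` remains. -/
theorem flipUnless_apply_eq_swap_apply (hab : a ≠ b) (hA : ∀ d, d = a ∨ d = b)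
    (hk : ∀ k, k ≠ i → k ≠ i' → x k = a) :
    flipUnless a b i i' h x = swap (fun _ => a) (Function.update (fun _ => a) i b) x := by
  rcases hA (x i') with hi' | hi'
  · rw [flipUnless_apply_of_apply_ne (by rw [hi']; exact hab)]
    have hx : x = Function.update (fun _ => a) i (x i) := by
      ext k
      by_cases hki : k = i
      · subst hki; simp
      · rw [Function.update_of_ne hki]
        by_cases hki' : k = i'
        · rw [hki', hi']
        · exact hk k hki hki'
    rcases hA (x i) with hi | hi
    · rw [hi] at hx
      have hx' : x = fun _ => a := by rw [hx]; simp
      rw [hx']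
      simp
    · rw [hi] at hx
      rw [hx]
      simp
  · rw [flipUnless_apply_eq_self hi' hk, swap_apply_of_ne_of_ne]
    · intro e
      exact hab (by rw [← hi', e])
    · intro e
      exact hab (by rw [← hi', e, Function.update_of_ne h])

/-- Off the square both factors are plain flips of different registers, so their product squares to
the identity; on it they are two transpositions sharing a point. -/
theorem flipUnless_mul_flipUnless_sq (hab : a ≠ b) (hA : ∀ d, d = a ∨ d = b) (h' : i ≠ i') :
    (flipUnless a b i i' h * flipUnless a b i' i h') ^ 2 =
      (swap (fun _ => a) (Function.update (fun _ => a) i b) *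
        swap (fun _ => a) (Function.update (fun _ => a) i' b)) ^ 2 := by
  ext x : 1
  simp only [pow_two, mul_apply]
  by_cases hx : ∀ k, k ≠ i → k ≠ i' → x k = a
  · have inv : ∀ x : Fin n → A, (∀ k, k ≠ i → k ≠ i' → x k = a) →
        ∀ k, k ≠ i → k ≠ i' → flipUnless a b i i' h x k = a := fun x hx k hk hk' => by
      rw [flipUnless, instruction_apply_of_ne _ _ _ hk, hx k hk hk']
    have inv' : ∀ x : Fin n → A, (∀ k, k ≠ i → k ≠ i' → x k = a) →
        ∀ k, k ≠ i → k ≠ i' → flipUnless a b i' i h' x k = a := fun x hx k hk hk' => by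
      rw [flipUnless, instruction_apply_of_ne _ _ _ hk', hx k hk hk']
    rw [← flipUnless_apply_eq_swap_apply (h := h') hab hA fun k h1 h2 => hx k h2 h1,
      ← flipUnless_apply_eq_swap_apply (h := h) hab hA (inv' _ hx),
      ← flipUnless_apply_eq_swap_apply (h := h') hab hA fun k h1 h2 => inv _ (inv' _ hx) k h2 h1,
      ← flipUnless_apply_eq_swap_apply (h := h) hab hA (inv' _ (inv _ (inv' _ hx)))]
  · push Not at hx
    obtain ⟨k, hk, hk', hka⟩ := hx
    have flip : ∀ x : Fin n → A, x k ≠ a →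
        flipUnless a b i i' h x = Function.update x i (swap a b (x i)) :=
      fun x hx => flipUnless_apply_of_exists_ne hk hk' hx
    have flip' : ∀ x : Fin n → A, x k ≠ a →
        flipUnless a b i' i h' x = Function.update x i' (swap a b (x i')) :=
      fun x hx => flipUnless_apply_of_exists_ne hk' hk hx
    have upd : ∀ x : Fin n → A, x k ≠ a → ∀ c, (Function.update x i c : Fin n → A) k ≠ a :=
      fun x hx c => by rwa [Function.update_of_ne hk]
    have upd' : ∀ x : Fin n → A, x k ≠ a → ∀ c, (Function.update x i' c : Fin n → A) k ≠ a :=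
      fun x hx c => by rwa [Function.update_of_ne hk']
    rw [flip' x hka, flip (Function.update x i' _) (upd' _ hka _),
      flip' (Function.update _ i _) (upd _ (upd' _ hka _) _),
      flip _ (upd' _ (upd _ (upd' _ hka _) _) _)]
    have hne : ∀ j, k ≠ j → ∀ c, x ≠ Function.update (fun _ => a) j c := fun j hj c e =>
      hka (by rw [e, Function.update_of_ne hj])
    have hnc : x ≠ fun _ => a := fun e => hka (by rw [e])
    rw [swap_apply_of_ne_of_ne hnc (hne i' hk' b), swap_apply_of_ne_of_ne hnc (hne i hk b),
      swap_apply_of_ne_of_ne hnc (hne i' hk' b), swap_apply_of_ne_of_ne hnc (hne i hk b)]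
    ext l
    by_cases hl : l = i
    · subst hl
      simp [h']
    by_cases hl' : l = i'
    · subst hl'
      simp [h]
    · simp [hl, hl']

/-- The instructions `flipUnless` on two registers and `shiftOff` on the others. -/
def flipFamily (a b : A) (i i' : Fin n) (h : i' ≠ i) (j : Fin n) : Perm (Fin n → A) :=
  if j = i then flipUnless a b i i' h
  else if j = i' then flipUnless a b i' i h.symm
  else if hj : i ≠ j then shiftOff {a} (swap a b) j hj else 1

theorem updatesOnly_flipFamily (j : Fin n) : UpdatesOnly (flipFamily a b i i' h j) j := by
  unfold flipFamily
  split_ifs with h1 h2 h3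
  · subst h1; exact updatesOnly_instruction _ _
  · subst h2; exact updatesOnly_instruction _ _
  · exact updatesOnly_instruction _ _
  · exact fun _ _ _ => rfl

theorem flipUnless_const (hab : a ≠ b) :
    flipUnless a b i i' h (fun _ => a) = Function.update (fun _ => a) i b := by
  rw [flipUnless_apply_of_apply_ne hab, swap_apply_left]

theorem flipFamily_ne_one (hab : a ≠ b) (j : Fin n) : flipFamily a b i i' h j ≠ 1 := by
  have hup : ∀ (x : Fin n → A) (k : Fin n), x k = a → Function.update x k b ≠ x :=
    fun x k hx e => hab (by rw [← hx, ← e, Function.update_self])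
  intro e
  by_cases h1 : j = i
  · have := DFunLike.congr_fun e (fun _ => a)
    rw [flipFamily, if_pos h1, flipUnless_const hab] at this
    exact hup _ _ rfl this
  by_cases h2 : j = i'
  · have := DFunLike.congr_fun e (fun _ => a)
    rw [flipFamily, if_neg h1, if_pos h2, flipUnless_const hab] at this
    exact hup _ _ rfl this
  have h3 : i ≠ j := fun e => h1 e.symm
  have := DFunLike.congr_fun e (Function.update (fun _ => a) i b)
  rw [flipFamily, if_neg h1, if_neg h2, dif_pos h3, ← pow_one (shiftOff _ _ _ _),
    shiftOff_pow_apply_of_notMem _ _ (by simpa using hab.symm), pow_one,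
    Function.update_of_ne h1, swap_apply_left] at this
  exact hup _ _ (Function.update_of_ne h1 _ _) this

/-- A set of states that is closed under all members of `flipFamily` and contains three suitable
states is everything. -/
theorem eq_univ_of_forall_flipFamily_mem (hab : a ≠ b) (hA : ∀ d, d = a ∨ d = b) {i'' : Fin n}
    (hi : i'' ≠ i) (hi' : i'' ≠ i') {C : Set (Fin n → A)}
    (hC : ∀ j, ∀ x ∈ C, flipFamily a b i i' h j x ∈ C)
    (h0 : Function.update (fun _ => a) i b ∈ C) (h1 : Function.update (fun _ => a) i' b ∈ C) :
    C = Set.univ := by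
  have hCi : ∀ x ∈ C, flipUnless a b i i' h x ∈ C := fun x hx => by
    simpa [flipFamily] using hC i x hx
  have hCi' : ∀ x ∈ C, flipUnless a b i' i h.symm x ∈ C := fun x hx => by
    simpa [flipFamily, h] using hC i' x hx
  have shift : ∀ x ∈ C, x i = b → ∀ x', x' i = x i → x' i' = x i' → x' ∈ C := by
    intro x hx hxi x' hx' hx''
    refine mem_of_forall_update_mem (i₀ := i) (K := {b}) (J := {j | j ≠ i ∧ j ≠ i'}) (by simp)
      ?_ hx hxi fun j hj => ?_
    · rintro x hx hxi j ⟨hj, hj'⟩ d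
      have hxa : x i ∉ ({a} : Finset A) := by
        rw [Finset.mem_singleton, Set.mem_singleton_iff.1 hxi]
        exact hab.symm
      have hflip := hC j x hx
      rw [flipFamily, if_neg hj, if_neg hj', dif_pos (fun e => hj e.symm),
        ← pow_one (shiftOff _ _ _ _), shiftOff_pow_apply_of_notMem _ _ hxa, pow_one] at hflip
      by_cases hd : x j = d
      · rw [← hd, Function.update_eq_self]
        exact hx
      · have : swap a b (x j) = d := by
          rcases hA (x j) with e | e <;> rcases hA d with e' | e' <;> simp_all
        rwa [this] at hflip
    · by_cases hji : j = i
      · rw [hji, hx']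
      · have : j = i' := by
          by_contra hne
          exact hj ⟨hji, hne⟩
        rw [this, hx'']
  have hba : ∀ x : Fin n → A, x i = b → x i' = a → x ∈ C := fun x hx hx' =>
    shift _ h0 (by simp) x (by simp [hx]) (by simp [h, hx'])
  have hbb : ∀ x : Fin n → A, x i = b → x i' = b → x ∈ C := by
    intro x hx hx'
    -- The register `i''` has the value `b` here, which rules out the exceptional case, so register
    -- `i'` really flips.
    have hmem := hCi' (fun k => if k = i' then a else b) (hba _ (by simp [h.symm]) (by simp))
    rw [flipUnless_apply_of_exists_ne hi' hi (by simpa [hi'] using hab.symm)] at hmem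
    exact shift _ hmem (by simp [h.symm]) x (by simp [h.symm, hx]) (by simp [hx'])
  have hb : ∀ x : Fin n → A, x i = b → x ∈ C := fun x hx =>
    (hA (x i')).elim (hba x hx) (hbb x hx)
  refine Set.eq_univ_of_forall fun x => ?_
  rcases hA (x i) with hx | hx
  · by_cases hfix : x i' = b ∧ ∀ k, k ≠ i → k ≠ i' → x k = a
    · convert h1
      ext k
      by_cases hk' : k = i'
      · subst hk'; simp [hfix.1]
      · rw [Function.update_of_ne hk']
        by_cases hk : k = i
        · rw [hk, hx]
        · exact hfix.2 k hk hk'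
    · have hmem := hCi (Function.update x i b) (hb _ (by simp))
      have hflip : flipUnless a b i i' h (Function.update x i b) = x := by
        have : flipUnless a b i i' h (Function.update x i b) =
            Function.update (Function.update x i b) i
              (swap a b ((Function.update x i b : Fin n → A) i)) := by
          by_cases hxi' : x i' = b
          · have : ∃ k, k ≠ i ∧ k ≠ i' ∧ x k ≠ a := by
              by_contra! hall
              exact hfix ⟨hxi', hall⟩
            obtain ⟨k, hk, hk', hka⟩ := this
            exact flipUnless_apply_of_exists_ne hk hk' (by rwa [Function.update_of_ne hk])
          · exact flipUnless_apply_of_apply_ne (by rwa [Function.update_of_ne h])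
        rw [this]
        simp [← hx]
      rwa [hflip] at hmem
  · exact hb x hx

variable [Fintype A]

/-- It is a product of `2 ^ (n - 1) - 1` disjoint transpositions, an odd number. -/
theorem sign_flipUnless (hab : a ≠ b) (hA : Fintype.card A = 2) (hn : 2 ≤ n) :
    sign (flipUnless a b i i' h) = -1 := by
  rw [flipUnless, sign_instruction_eq_neg_one_pow
    (P := {Function.update (fun _ => a) ⟨i', h⟩ b})]
  · rw [hA, Finset.card_singleton]
    refine Odd.neg_one_pow (Nat.Even.sub_odd (Nat.one_le_two_pow) ?_ odd_one)
    exact even_two.pow_of_ne_zero (by omega)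
  · intro y
    simp only [Finset.mem_singleton]
    split_ifs <;> simp [hab]

theorem closure_flipFamily_eq_top (hab : a ≠ b) (hA : Fintype.card A = 2) {i'' : Fin n}
    (hi : i'' ≠ i) (hi' : i'' ≠ i') (hn : 2 ≤ n) :
    Subgroup.closure (Set.range (flipFamily a b i i' h)) = ⊤ := by
  have hA' : ∀ d, d = a ∨ d = b := fun d => by
    have : d ∈ ({a, b} : Finset A) := by
      rw [Finset.eq_univ_of_card {a, b} (by rw [hA, Finset.card_pair hab])]
      exact Finset.mem_univ d
    simpa using this
  set G := Subgroup.closure (Set.range (flipFamily a b i i' h))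
  have hmem : ∀ j, flipFamily a b i i' h j ∈ G := fun j => Subgroup.subset_closure ⟨j, rfl⟩
  have hmi : flipUnless a b i i' h ∈ G := by simpa [flipFamily] using hmem i
  have hmi' : flipUnless a b i' i h.symm ∈ G := by simpa [flipFamily, h] using hmem i'
  set p : Fin n → A := fun _ => a with hp
  set e := Function.update p i b with he
  set e' := Function.update p i' b with he'
  have hpe : p ≠ e := fun h' => hab (by simpa [he, hp] using congrFun h' i)
  have hpe' : p ≠ e' := fun h' => hab (by simpa [he', hp] using congrFun h' i')
  have hee' : e ≠ e' := fun h' => hab (by simpa [he, he', hp, h] using congrFun h' i')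
  have hcyc := isThreeCycle_swap_mul_swap_same hpe hpe' hee'
  have htG : (swap p e * swap p e') ^ 2 ∈ G := by
    rw [← flipUnless_mul_flipUnless_sq (h := h) hab hA' h.symm]
    exact pow_mem (mul_mem hmi hmi') 2
  rw [pow_two] at htG
  refine eq_top_of_alternatingGroup_le ?_ hmi (sign_flipUnless hab hA hn)
  refine alternatingGroup_le_of_isThreeCycle_of_block hcyc.isThreeCycle_sq htG fun C hC hblock => ?_
  have hSp : (swap p e * swap p e') p = e' := by
    rw [mul_apply, swap_apply_left, swap_apply_of_ne_of_ne hpe'.symm hee'.symm]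
  have hSe' : (swap p e * swap p e') e' = e := by
    rw [mul_apply, swap_apply_right, swap_apply_left]
  have hSe : (swap p e * swap p e') e = p := by
    rw [mul_apply, swap_apply_of_ne_of_ne hpe.symm hee', swap_apply_right]
  have hpC : p ∈ C := hC p (by rw [mul_apply _ _ p, hSp, hSe']; exact hpe.symm)
  have heC : e ∈ C := hC e (by rw [mul_apply _ _ e, hSe, hSp]; exact hee'.symm)
  have heC' : e' ∈ C := hC e' (by rw [mul_apply _ _ e', hSe', hSe]; exact hpe')
  refine eq_univ_of_forall_flipFamily_mem (h := h) hab hA' hi hi' (fun j x hx => ?_) heC heC'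
  -- Each generator sends `p` to `p`, `e` or `e'`, all in `C`, so each generator preserves the
  -- block.
  refine hblock _ (hmem j) p hpC ?_ x hx
  by_cases h1 : j = i
  · rw [flipFamily, if_pos h1, flipUnless_const hab]
    exact heC
  by_cases h2 : j = i'
  · rw [flipFamily, if_neg h1, if_pos h2, flipUnless_const hab]
    exact heC'
  · rw [flipFamily, if_neg h1, if_neg h2, dif_pos (fun e => h1 e.symm),
      shiftOff_apply_of_mem _ _ (by simp [hp])]
    exact hpC

end Binary

theorem theorem1 {A : Type*} [Fintype A] [DecidableEq A] (n : ℕ)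
    (hq : 2 ≤ Fintype.card A) (hn : 2 ≤ n) :
    (¬ (Fintype.card A = 2 ∧ n = 2) →
      ∃ S : Finset (Equiv.Perm (Fin n → A)),
        S.card = n ∧ (∀ g ∈ S, IsInstruction g) ∧
          Subgroup.closure (S : Set (Equiv.Perm (Fin n → A))) = ⊤) ∧
    (3 ≤ Fintype.card A →
      ∃ S : Finset (Equiv.Perm (Fin n → A)),
        S.card = n ∧ (∀ g ∈ S, IsInstruction g) ∧
          Subgroup.closure (S : Set (Equiv.Perm (Fin n → A))) =
            alternatingGroup (Fin n → A)) := by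
  have h01 : (⟨1, by omega⟩ : Fin n) ≠ ⟨0, by omega⟩ := by simp
  have main : ∀ H : Subgroup (Equiv.Perm (Fin n → A)),
      (∃ g : Fin n → Perm (Fin n → A), (∀ j, UpdatesOnly (g j) j) ∧ (∀ j, g j ≠ 1) ∧
        Subgroup.closure (Set.range g) = H) →
      ∃ S : Finset (Equiv.Perm (Fin n → A)), S.card = n ∧ (∀ g ∈ S, IsInstruction g) ∧
        Subgroup.closure (S : Set (Equiv.Perm (Fin n → A))) = H := by
    rintro H ⟨g, hg, hne, rfl⟩
    obtain ⟨S, hS, hSi, hSg⟩ := exists_finset_of_forall_updatesOnly g hg hne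
    exact ⟨S, hS, hSi, by rw [hSg]⟩
  refine ⟨fun hqn => main _ ?_, fun hq3 => main _ ?_⟩
  · rcases hq.eq_or_lt with hq2 | hq3
    · obtain ⟨a, b, hab⟩ := Fintype.exists_pair_of_one_lt_card hq
      have hn3 : 2 < n := by omega
      exact ⟨flipFamily a b _ _ h01, updatesOnly_flipFamily, flipFamily_ne_one hab,
        closure_flipFamily_eq_top (i'' := ⟨2, hn3⟩) hab hq2.symm (by simp) (by simp) hn⟩
    · exact exists_linkingFamily_closure_eq_top hq3 h01
  · rcases hq3.eq_or_lt with hq3 | hq4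
    · exact exists_linkingFamily_closure_eq_alternatingGroup_of_card_eq_three hq3.symm
        ⟨0, by omega⟩
    · rcases Nat.even_or_odd (Fintype.card A) with he | ho
      · exact exists_linkingFamily_closure_eq_alternatingGroup_of_even hq4 he hn h01
      · exact exists_linkingFamily_closure_eq_alternatingGroup_of_odd hq4 ho h01
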